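/- Let $N\ge 2$ be an integer and let $\phi:(0,+\infty)\to[0,+\infty)$ be continuous and strictly decreasing with $\lim_{t\to0^+}\phi(t)=+\infty$; put $\phi(0)=+\infty$. For $d\ge1$ and a Borel probability measure $\rho$ on $\mathbb R^d$ let $\Pi(\rho)$ be the set of Borel probability measures on $(\mathbb R^d)^N$ all of whose $N$ marginals on $\mathbb R^d$ are equal to $\rho$, and let $$C(\rho)=\inf_{P\in\Pi(\rho)}\int_{(\mathbb R^d)^N}\ \sum_{1\le i<j\le N}\phi(|x_i-x_j|)\,dP(x_1,\dots,x_N)\in[0,+\infty].$$ A probability density $\rho$ on $\mathbb R^d$ (that is, $\rho\in L^1(\mathbb R^d)$, $\rho\ge0$, $\int\rho\,dx=1$) is identified with the measure $\rho\,dx$. (i) Let $d\ge1$, $1<p\le\infty$, and let $S$ be a set of probability densities on $\mathbb R^d$ with $\sup_{\rho\in S}\|\rho\|_{L^p}<\infty$. Then $C$ is finite on $S$ and Lipschitz continuous on $S$ for the $L^1$ distance: there is a constant $K$ such that $|C(\rho_1)-C(\rho_2)|\le K\|\rho_1-\rho_2\|_{L^1}$ for all $\rho_1,\rho_2\in S$.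 (ii) Let $\mathcal H=\{\rho\in L^1(\mathbb R^3):\rho\ge0,\ \sqrt\rho\in H^1(\mathbb R^3),\ \int\rho\,dx=1\}$, and let $S\subset\mathcal H$ satisfy $\sup_{\rho\in S}\|\sqrt\rho\|_{H^1}<\infty$. Then $C$ is finite on $S$, and there is a constant $K$ such that $|C(\rho_1)-C(\rho_2)|\le K\|\rho_1-\rho_2\|_{L^1}$ for all $\rho_1,\rho_2\in S$. -/

import Mathlib

open MeasureTheory Set Filter Topology
open scoped ENNReal NNReal ContDiff

noncomputable section

namespace RepulsiveTransport

/-- The Euclidean space `ℝ^d`. -/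
abbrev Space (d : ℕ) : Type := EuclideanSpace ℝ (Fin d)

/-- The class of repulsive pair potentials: `φ : (0, ∞) → [0, ∞)` is continuous, strictly
decreasing, and tends to `+∞` at `0+`. Values of `φ` outside `(0, ∞)` are never used. -/
structure IsRepulsivePotential (φ : ℝ → ℝ) : Prop where
  continuousOn : ContinuousOn φ (Ioi 0)
  nonneg : ∀ t, 0 < t → 0 ≤ φ t
  tendsto_zero : Tendsto φ (𝓝[>] 0) atTop
  strictAntiOn : StrictAntiOn φ (Ioi 0)

/-- The pair interaction `φ(|x - y|)`, equal to `φ(0+) = +∞` if `x = y`. -/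
def pairCost {d : ℕ} (φ : ℝ → ℝ) (x y : Space d) : ℝ≥0∞ :=
  open Classical in if x = y then ⊤ else ENNReal.ofReal (φ ‖x - y‖)

/-- The cost `c(x₁, …, x_N) = ∑_{i < j} φ(|x_i - x_j|)`. -/
def cost {d : ℕ} (N : ℕ) (φ : ℝ → ℝ) (x : Fin N → Space d) : ℝ≥0∞ :=
  ∑ q : Fin N × Fin N with q.1 < q.2, pairCost φ (x q.1) (x q.2)

/-- The set `Π(ρ)` of transport plans: probabilities on `(ℝ^d)^N` all of whose `N` marginals
are equal to `ρ`. -/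
def plans {d : ℕ} (N : ℕ) (ρ : Measure (Space d)) : Set (Measure (Fin N → Space d)) :=
  {P | IsProbabilityMeasure P ∧ ∀ i : Fin N, P.map (fun x => x i) = ρ}

/-- The multimarginal transport cost `C(ρ)`, with values in `[0, ∞]`. -/
def transportCost {d : ℕ} (N : ℕ) (φ : ℝ → ℝ) (ρ : Measure (Space d)) : ℝ≥0∞ :=
  ⨅ P ∈ plans N ρ, ∫⁻ x, cost N φ x ∂P

/-- The absolutely continuous probabilities on `ℝ^d`, as a subset of `L¹(ℝ^d)`. -/
def probDensities (d : ℕ) : Set (Lp ℝ 1 (volume : Measure (Space d))) :=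
  {ρ | 0 ≤ ρ ∧ ∫ x, ρ x = 1}

/-- The measure `ρ(x) dx`. -/
def densityMeasure {d : ℕ} (ρ : Lp ℝ 1 (volume : Measure (Space d))) : Measure (Space d) :=
  volume.withDensity (fun x => ENNReal.ofReal (ρ x))

/-- The functional `C` on densities. -/
def densityCost {d : ℕ} (N : ℕ) (φ : ℝ → ℝ) (ρ : Lp ℝ 1 (volume : Measure (Space d))) : ℝ≥0∞ :=
  transportCost N φ (densityMeasure ρ)

/-- `G` is the weak gradient of `u` on `ℝ^d`. -/
structure IsWeakGradient {d : ℕ} (u : Space d → ℝ) (G : Space d → Space d) : Prop where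
  locallyIntegrable : LocallyIntegrable u volume
  locallyIntegrable_grad : LocallyIntegrable G volume
  integral_eq : ∀ ψ : Space d → ℝ, ContDiff ℝ ∞ ψ → HasCompactSupport ψ → ∀ v : Space d,
    ∫ x, u x * fderiv ℝ ψ x v = -∫ x, ψ x * inner ℝ (G x) v

/-- `u ∈ H¹(ℝ^d)`. -/
def MemH1 {d : ℕ} (u : Space d → ℝ) : Prop :=
  MemLp u 2 volume ∧ ∃ G, IsWeakGradient u G ∧ MemLp G 2 volume

/-- The norm `‖u‖_{H¹} = (‖u‖₂² + ‖∇u‖₂²)^{1/2}`, equal to `+∞` if `u` is not in `H¹`. The weak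
gradient is unique up to null sets, so that the infimum is over equal numbers. -/
def eH1Norm {d : ℕ} (u : Space d → ℝ) : ℝ≥0∞ :=
  ⨅ (G : Space d → Space d) (_ : IsWeakGradient u G),
    (eLpNorm u 2 volume ^ 2 + eLpNorm G 2 volume ^ 2) ^ (1 / 2 : ℝ)

/-- The set `H` of densities `ρ ∈ L¹(ℝ³)` with `ρ ≥ 0`, `√ρ ∈ H¹(ℝ³)` and `∫ ρ = 1`. -/
def dftDensities : Set (Lp ℝ 1 (volume : Measure (Space 3))) :=
  {ρ | 0 ≤ ρ ∧ MemH1 (fun x => √(ρ x)) ∧ ∫ x, ρ x = 1}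

end RepulsiveTransport

end

/-!
Let `P` be a plan for `ρ₁` and `δ` the total mass of `(ρ₁ - ρ₂)⁺`. Removing from `P` a part whose
`i`-th marginal is `(ρ₁ - ρ₂)⁺`, for each `i`, leaves a plan `Q ≤ P` which misses at most `N δ` of
the mass and whose marginals are below `ρ₂`. What `Q` lacks of `ρ₂` may be concentrated at the scale
of its own mass, so one gives up a further fraction `s = O(N² δ)` of `Q`: relative to its mass, the
missing part is then as diffuse as `ρ₂`. Diffuse marginals admit a plan under which the particles
stay at distance at least `r` from each other almost surely, so completing `(1 - s) Q` by such a
plan of the missing part raises the cost by at most `O(N⁴ φ(r) δ)`.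

It remains to find `r` such that all densities of the family give mass at most `1 / (8 N)` to balls
of radius `r`. Under the `Lᵖ` bound this is Hölder's inequality. Under the `H¹` bound, among `k²`
disjoint translates of a ball one has mass at most `k⁻²`, and the `L²` modulus of continuity of `√ρ`
carries this bound back to the ball itself, so that no Sobolev embedding is needed.
-/

namespace RepulsiveTransport

section Couplings

variable {α β : Type*} [MeasurableSpace α] [MeasurableSpace β]

theorem fst_withDensity_inv_measure_section (T : Measure α) [SFinite T] (Q : Measure β)
    [SFinite Q] {G : Set (α × β)} (hG : MeasurableSet G) (hpos : ∀ t, Q (Prod.mk t ⁻¹' G) ≠ 0)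
    (hfin : ∀ t, Q (Prod.mk t ⁻¹' G) ≠ ⊤) :
    ((T.prod Q).withDensity (G.indicator fun p => (Q (Prod.mk p.1 ⁻¹' G))⁻¹)).fst = T := by
  set w : α × β → ℝ≥0∞ := G.indicator fun p => (Q (Prod.mk p.1 ⁻¹' G))⁻¹
  have hw : Measurable w :=
    ((measurable_measure_prodMk_left hG).comp measurable_fst).inv.indicator hG
  have lintegral_section : ∀ t, ∫⁻ y, w (t, y) ∂Q = 1 := fun t => calc
    ∫⁻ y, w (t, y) ∂Q
        = ∫⁻ y, (Prod.mk t ⁻¹' G).indicator (fun _ => (Q (Prod.mk t ⁻¹' G))⁻¹) y ∂Q := rfl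
    _ = (Q (Prod.mk t ⁻¹' G))⁻¹ * Q (Prod.mk t ⁻¹' G) :=
        lintegral_indicator_const (measurable_prodMk_left hG) _
    _ = 1 := ENNReal.inv_mul_cancel (hpos t) (hfin t)
  ext A hA
  rw [Measure.fst_apply hA, withDensity_apply _ (measurable_fst hA), ← prod_univ,
    ← Measure.prod_restrict, Measure.restrict_univ, lintegral_prod _ hw.aemeasurable]
  simp_rw [lintegral_section]
  rw [setLIntegral_one]

theorem exists_partial_coupling (T : Measure α) [IsFiniteMeasure T] (Q : Measure β)
    [IsFiniteMeasure Q] {G : Set (α × β)} (hG : MeasurableSet G) {c : ℝ≥0∞} (hc : c ≠ 0)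
    (hQ : ∀ t, c ≤ Q (Prod.mk t ⁻¹' G)) (hT : T univ ≤ c) :
    ∃ J : Measure (α × β), J.fst = T ∧ J.snd ≤ Q ∧ ∀ᵐ p ∂J, p ∈ G := by
  set w : α × β → ℝ≥0∞ := G.indicator fun p => (Q (Prod.mk p.1 ⁻¹' G))⁻¹
  have hw : Measurable w :=
    ((measurable_measure_prodMk_left hG).comp measurable_fst).inv.indicator hG
  have w_le : ∀ p, w p ≤ c⁻¹ := fun p =>
    (indicator_le_self' (fun _ _ => zero_le) p).trans (ENNReal.inv_le_inv.2 (hQ p.1))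
  refine ⟨(T.prod Q).withDensity w, ?_, ?_, ?_⟩
  · exact fst_withDensity_inv_measure_section T Q hG
      (fun t => ((pos_iff_ne_zero.2 hc).trans_le (hQ t)).ne') fun t => measure_ne_top _ _
  · refine Measure.le_iff.2 fun B hB => ?_
    calc ((T.prod Q).withDensity w).snd B
        = ∫⁻ p in Prod.snd ⁻¹' B, w p ∂(T.prod Q) := by
          rw [Measure.snd_apply hB, withDensity_apply _ (measurable_snd hB)]
      _ ≤ ∫⁻ _ in Prod.snd ⁻¹' B, c⁻¹ ∂(T.prod Q) := lintegral_mono w_le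
      _ = c⁻¹ * (T univ * Q B) := by rw [setLIntegral_const, ← univ_prod, Measure.prod_prod]
      _ ≤ c⁻¹ * (c * Q B) := by gcongr
      _ ≤ Q B := by
          rw [← mul_assoc]
          exact mul_le_of_le_one_left zero_le (ENNReal.inv_mul_le_one c)
  · exact (ae_withDensity_iff hw).2 (Eventually.of_forall fun p => mem_of_indicator_ne_zero)

theorem inv_four_le_measure_inter {μ : Measure α} [IsProbabilityMeasure μ] {A B C : Set α}
    (hA : μ Aᶜ ≤ 4⁻¹) (hB : μ Bᶜ ≤ 4⁻¹) (hC : μ Cᶜ ≤ 4⁻¹) : 4⁻¹ ≤ μ (A ∩ B ∩ C) := by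
  have four_quarters : (4⁻¹ + (4⁻¹ + 4⁻¹ + 4⁻¹) : ℝ≥0∞) = 1 := by
    rw [← ENNReal.mul_inv_cancel (a := 4) (by simp) (by simp)]
    ring
  have hcompl : μ (A ∩ B ∩ C)ᶜ ≤ 4⁻¹ + 4⁻¹ + 4⁻¹ := by
    rw [compl_inter, compl_inter]
    exact (measure_union_le _ _).trans
      (add_le_add ((measure_union_le _ _).trans (add_le_add hA hB)) hC)
  refine ENNReal.le_of_add_le_add_right (a := 4⁻¹ + 4⁻¹ + 4⁻¹) (by finiteness) ?_
  calc 4⁻¹ + (4⁻¹ + 4⁻¹ + 4⁻¹) = μ univ := by rw [four_quarters, measure_univ]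
    _ ≤ μ (A ∩ B ∩ C) + μ (A ∩ B ∩ C)ᶜ := by
        rw [← union_compl_self (A ∩ B ∩ C)]
        exact measure_union_le _ _
    _ ≤ μ (A ∩ B ∩ C) + (4⁻¹ + 4⁻¹ + 4⁻¹) := by gcongr

/-- For a measure `J` on pairs of points of `α × β`: the measure on `α × β` formed by both points
of each pair, after an exchange of their second coordinates. -/
noncomputable def exchange (J : Measure ((α × β) × α × β)) : Measure (α × β) :=
  J.map (fun q => (q.1.1, q.2.2)) + J.map fun q => (q.2.1, q.1.2)

theorem fst_exchange (J : Measure ((α × β) × α × β)) : (exchange J).fst = (J.fst + J.snd).fst := by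
  rw [exchange, Measure.fst_add, Measure.fst_add, Measure.fst_map_prodMk (by fun_prop),
    Measure.fst_map_prodMk (by fun_prop)]
  simp only [Measure.fst, Measure.snd]
  rw [Measure.map_map (by fun_prop) (by fun_prop), Measure.map_map (by fun_prop) (by fun_prop)]
  rfl

theorem snd_exchange (J : Measure ((α × β) × α × β)) : (exchange J).snd = (J.fst + J.snd).snd := by
  rw [exchange, Measure.snd_add, Measure.snd_add, Measure.snd_map_prodMk (by fun_prop),
    Measure.snd_map_prodMk (by fun_prop), add_comm]
  simp only [Measure.fst, Measure.snd]
  rw [Measure.map_map (by fun_prop) (by fun_prop), Measure.map_map (by fun_prop) (by fun_prop)]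
  rfl

theorem ae_exchange {J : Measure ((α × β) × α × β)} {G : Set (α × β)} (hG : MeasurableSet G)
    (hJ : ∀ᵐ q ∂J, (q.1.1, q.2.2) ∈ G ∧ (q.2.1, q.1.2) ∈ G) : ∀ᵐ p ∂exchange J, p ∈ G := by
  refine ae_add_measure_iff.2
    ⟨(ae_map_iff (by fun_prop) hG).2 ?_, (ae_map_iff (by fun_prop) hG).2 ?_⟩
  exacts [hJ.mono fun _ h => h.1, hJ.mono fun _ h => h.2]

-- Start from the product measure. By `exists_partial_coupling` its part outside `G` is matched
-- with some of its part inside `G`, in such a way that exchanging second coordinates moves both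
-- into `G`.
theorem exists_coupling_ae_mem (μ : Measure α) [IsProbabilityMeasure μ] (ν : Measure β)
    [IsProbabilityMeasure ν] {G : Set (α × β)} (hG : MeasurableSet G)
    (hν : ∀ y, ν (Prod.mk y ⁻¹' Gᶜ) ≤ 4⁻¹)
    (hμ : ∀ x, μ ((fun y => (y, x)) ⁻¹' Gᶜ) ≤ 4⁻¹) :
    ∃ π : Measure (α × β), π.fst = μ ∧ π.snd = ν ∧ ∀ᵐ p ∂π, p ∈ G := by
  set bad : Measure (α × β) := (μ.prod ν).restrict Gᶜ with bad_def
  set good : Measure (α × β) := (μ.prod ν).restrict G with good_def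
  have good_add_bad : good + bad = μ.prod ν := Measure.restrict_add_restrict_compl hG
  have measure_compl : (μ.prod ν) Gᶜ ≤ 4⁻¹ := calc
    (μ.prod ν) Gᶜ = ∫⁻ y, ν (Prod.mk y ⁻¹' Gᶜ) ∂μ := Measure.prod_apply hG.compl
    _ ≤ ∫⁻ _, 4⁻¹ ∂μ := lintegral_mono hν
    _ = 4⁻¹ := by simp
  set W : Set ((α × β) × α × β) := {q | (q.1.1, q.2.2) ∈ G ∧ (q.2.1, q.1.2) ∈ G}
  have hW : MeasurableSet W :=
    (hG.preimage (by fun_prop : Measurable fun q : (α × β) × α × β => (q.1.1, q.2.2))).inter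
      (hG.preimage (by fun_prop : Measurable fun q : (α × β) × α × β => (q.2.1, q.1.2)))
  have le_good_section : ∀ p, 4⁻¹ ≤ good (Prod.mk p ⁻¹' W) := by
    rintro ⟨t, x⟩
    rw [good_def, Measure.restrict_apply (measurable_prodMk_left hW)]
    refine inv_four_le_measure_inter (A := Prod.snd ⁻¹' (Prod.mk t ⁻¹' G))
      (B := Prod.fst ⁻¹' ((fun y => (y, x)) ⁻¹' G)) ?_ ?_ measure_compl
    · rw [← preimage_compl, ← univ_prod, Measure.prod_prod, measure_univ, one_mul]
      exact hν t
    · rw [← preimage_compl, ← prod_univ, Measure.prod_prod, measure_univ, mul_one]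
      exact hμ x
  obtain ⟨J, J_fst, J_snd, hJ⟩ := exists_partial_coupling bad good hW (c := 4⁻¹) (by simp)
    le_good_section (by rwa [bad_def, Measure.restrict_apply_univ])
  have := isFiniteMeasure_of_le good J_snd
  have reassemble : (good - J.snd) + (J.fst + J.snd) = μ.prod ν := by
    rw [add_comm J.fst, ← add_assoc, Measure.sub_add_cancel_of_le J_snd, J_fst, good_add_bad]
  refine ⟨(good - J.snd) + exchange J, ?_, ?_, ae_add_measure_iff.2 ⟨?_, ae_exchange hG hJ⟩⟩
  · rw [Measure.fst_add, fst_exchange, ← Measure.fst_add, reassemble, Measure.fst_prod]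
  · rw [Measure.snd_add, snd_exchange, ← Measure.snd_add, reassemble, Measure.snd_prod]
  · exact ae_mono Measure.sub_le (ae_restrict_mem hG)

theorem measure_biUnion_le_inv_four {ι : Type*} [Fintype ι] {μ : Measure α} {A : ι → Set α}
    (hA : ∀ i, μ (A i) ≤ (4 * Fintype.card ι : ℝ≥0∞)⁻¹) (s : Finset ι) :
    μ (⋃ i ∈ s, A i) ≤ 4⁻¹ := by
  set n : ℝ≥0∞ := (Fintype.card ι : ℝ≥0∞)
  calc μ (⋃ i ∈ s, A i) ≤ ∑ i ∈ s, μ (A i) := measure_biUnion_finset_le s A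
    _ ≤ ∑ i, (4 * n)⁻¹ :=
        (Finset.sum_le_sum fun i _ => hA i).trans
          (Finset.sum_le_sum_of_subset (Finset.subset_univ s))
    _ = (4 * n)⁻¹ * n := by
        rw [Finset.sum_const, Finset.card_univ, nsmul_eq_mul, mul_comm]
    _ ≤ 4⁻¹ := by
        rw [ENNReal.le_inv_iff_mul_le, mul_assoc, mul_comm n]
        exact ENNReal.inv_mul_le_one _

end Couplings

theorem map_eval_map_update_self {ι X : Type*} [DecidableEq ι] [MeasurableSpace X]
    (π : Measure ((ι → X) × X)) (k : ι) :
    (π.map fun p => Function.update p.1 k p.2).map (fun x => x k) = π.snd := by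
  rw [Measure.map_map (measurable_pi_apply k) measurable_update', Measure.snd]
  simp [Function.comp_def]

theorem map_eval_map_update_of_ne {ι X : Type*} [DecidableEq ι] [MeasurableSpace X]
    (π : Measure ((ι → X) × X)) {i k : ι} (hik : i ≠ k) :
    (π.map fun p => Function.update p.1 k p.2).map (fun x => x i) = π.fst.map fun x => x i := by
  rw [Measure.map_map (measurable_pi_apply i) measurable_update', Measure.fst,
    Measure.map_map (measurable_pi_apply i) measurable_fst]
  simp [Function.comp_def, hik]

theorem pairwise_insert_le_dist_update {ι X : Type*} [DecidableEq ι] [PseudoMetricSpace X]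
    {s : Finset ι} {k : ι} (hk : k ∉ s) {x : ι → X} {y : X} {r : ℝ}
    (hx : (s : Set ι).Pairwise fun i j => r ≤ dist (x i) (x j)) (hy : ∀ i ∈ s, r ≤ dist (x i) y) :
    (insert k s : Set ι).Pairwise fun i j =>
      r ≤ dist (Function.update x k y i) (Function.update x k y j) := by
  have hne : ∀ i ∈ s, i ≠ k := fun i hi => ne_of_mem_of_not_mem hi hk
  rw [pairwise_insert_of_notMem (by exact_mod_cast hk)]
  refine ⟨fun i hi j hj hij => ?_, fun i hi => ?_⟩
  · simpa [hne i hi, hne j hj] using hx hi hj hij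
  · simpa [hne i hi, dist_comm] using hy i hi

section SeparatedCoupling

variable {ι X : Type*} [PseudoMetricSpace X] [SecondCountableTopology X] [MeasurableSpace X]
  [OpensMeasurableSpace X]

theorem measurableSet_forall_le_dist [Countable ι] (s : Finset ι) (r : ℝ) :
    MeasurableSet {p : (ι → X) × X | ∀ i ∈ s, r ≤ dist (p.1 i) p.2} := by
  simp only [ofPred_forall]
  exact .iInter fun i => .iInter fun _ => measurableSet_le measurable_const
    (((measurable_pi_apply i).comp measurable_fst).dist measurable_snd)

theorem measurableSet_pairwise_le_dist [Countable ι] (s : Finset ι) (r : ℝ) :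
    MeasurableSet {x : ι → X | (s : Set ι).Pairwise fun i j => r ≤ dist (x i) (x j)} := by
  simp only [Set.Pairwise, ofPred_forall]
  exact .iInter fun i => .iInter fun _ => .iInter fun j => .iInter fun _ => .iInter fun _ =>
    measurableSet_le measurable_const ((measurable_pi_apply i).dist (measurable_pi_apply j))

theorem exists_coupling_pairwise_le_dist_on [Fintype ι] {η : ι → Measure X}
    [∀ i, IsProbabilityMeasure (η i)] {r : ℝ}
    (hη : ∀ i x, η i (Metric.ball x r) ≤ (4 * Fintype.card ι : ℝ≥0∞)⁻¹) (s : Finset ι) :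
    ∃ P : Measure (ι → X), IsProbabilityMeasure P ∧ (∀ i, P.map (fun x => x i) = η i) ∧
      ∀ᵐ x ∂P, (s : Set ι).Pairwise fun i j => r ≤ dist (x i) (x j) := by
  classical
  induction s using Finset.induction_on with
  | empty =>
    exact ⟨Measure.pi η, inferInstance, fun i => (measurePreserving_eval η i).map_eq, by simp⟩
  | insert k s hk ih =>
    obtain ⟨P, _, hP, hPs⟩ := ih
    have hmeas := fun i => measurable_pi_apply (X := fun _ : ι => X) i
    have close_to_config : ∀ y : ι → X,
        η k (Prod.mk y ⁻¹' {p | ∀ i ∈ s, r ≤ dist (p.1 i) p.2}ᶜ) ≤ 4⁻¹ := fun y =>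
      (measure_mono fun x hx => by simpa [dist_comm] using hx).trans
        (measure_biUnion_le_inv_four (fun i => hη k (y i)) s)
    have close_to_point : ∀ x : X,
        P ((fun y => (y, x)) ⁻¹' {p | ∀ i ∈ s, r ≤ dist (p.1 i) p.2}ᶜ) ≤ 4⁻¹ := by
      refine fun x => (measure_mono fun y hy => by simpa using hy).trans
        (measure_biUnion_le_inv_four (A := fun i => (fun y => y i) ⁻¹' Metric.ball x r)
          (fun i => ?_) s)
      rw [← Measure.map_apply (hmeas i) Metric.isOpen_ball.measurableSet, hP]
      exact hη i x
    obtain ⟨π, π_fst, π_snd, hπ⟩ := exists_coupling_ae_mem P (η k)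
      (measurableSet_forall_le_dist s r) close_to_config close_to_point
    have hupdate : Measurable fun p : (ι → X) × X => Function.update p.1 k p.2 :=
      measurable_update'
    have : IsProbabilityMeasure π := ⟨by rw [← Measure.fst_univ, π_fst, measure_univ]⟩
    refine ⟨π.map fun p => Function.update p.1 k p.2,
      Measure.isProbabilityMeasure_map hupdate.aemeasurable, fun i => ?_, ?_⟩
    · rcases eq_or_ne i k with rfl | hik
      · rw [map_eval_map_update_self, π_snd]
      · rw [map_eval_map_update_of_ne π hik, π_fst, hP]
    · rw [← π_fst] at hPs
      refine (ae_map_iff hupdate.aemeasurable (measurableSet_pairwise_le_dist _ r)).2 ?_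
      filter_upwards [hπ, ae_of_ae_map measurable_fst.aemeasurable hPs] with p hpk hps
      rw [Finset.coe_insert]
      exact pairwise_insert_le_dist_update hk hps hpk

theorem exists_coupling_pairwise_le_dist [Fintype ι] {η : ι → Measure X} {M : ℝ≥0∞} (hM : M ≠ ⊤)
    (hη : ∀ i, η i univ = M) {r : ℝ}
    (hball : ∀ i x, 4 * Fintype.card ι * η i (Metric.ball x r) ≤ M) :
    ∃ P : Measure (ι → X), P univ = M ∧ (∀ i, P.map (fun x => x i) = η i) ∧
      ∀ᵐ x ∂P, Pairwise fun i j => r ≤ dist (x i) (x j) := by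
  rcases eq_or_ne M 0 with rfl | hM0
  · refine ⟨0, by simp, fun i => ?_, by simp⟩
    rw [Measure.map_zero, Measure.measure_univ_eq_zero.1 (hη i)]
  have (i : ι) : IsProbabilityMeasure (M⁻¹ • η i) :=
    ⟨by rw [Measure.smul_apply, hη, smul_eq_mul, ENNReal.inv_mul_cancel hM0 hM]⟩
  have hscaled : ∀ i x, (M⁻¹ • η i) (Metric.ball x r) ≤ (4 * Fintype.card ι : ℝ≥0∞)⁻¹ := by
    intro i x
    rw [Measure.smul_apply, smul_eq_mul, ENNReal.le_inv_iff_mul_le, mul_assoc, mul_comm (η i _)]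
    exact (mul_le_mul_right (hball i x) M⁻¹).trans (ENNReal.inv_mul_le_one M)
  obtain ⟨P, _, hP, hPr⟩ := exists_coupling_pairwise_le_dist_on hscaled Finset.univ
  refine ⟨M • P, ?_, fun i => ?_, ?_⟩
  · rw [Measure.smul_apply, measure_univ, smul_eq_mul, mul_one]
  · rw [Measure.map_smul, hP, smul_smul, ENNReal.mul_inv_cancel hM0 hM, one_smul]
  · filter_upwards [Measure.ae_smul_measure hPr M] with x hx
    simpa [Set.pairwise_univ] using hx

end SeparatedCoupling

section Subplans

variable {Ω α : Type*} [MeasurableSpace Ω] [MeasurableSpace α]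

theorem exists_withDensity_eq_of_le {μ ν : Measure α} [IsFiniteMeasure ν] (h : μ ≤ ν) :
    ∃ g : α → ℝ≥0∞, Measurable g ∧ (∀ x, g x ≤ 1) ∧ ν.withDensity g = μ := by
  have := isFiniteMeasure_of_le ν h
  refine ⟨fun x => min (μ.rnDeriv ν x) 1, (Measure.measurable_rnDeriv _ _).min measurable_const,
    fun x => min_le_right _ _, ?_⟩
  refine (withDensity_congr_ae ?_).trans
    (Measure.withDensity_rnDeriv_eq μ ν (Measure.absolutelyContinuous_of_le h))
  filter_upwards [Measure.rnDeriv_le_one_of_le h] with x hx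
  exact min_eq_left hx

theorem exists_le_map_eq_of_le_map {P : Measure Ω} [IsFiniteMeasure P] {f : Ω → α}
    (hf : Measurable f) {τ : Measure α} (h : τ ≤ P.map f) : ∃ τ' ≤ P, τ'.map f = τ := by
  obtain ⟨g, hg, hg1, rfl⟩ := exists_withDensity_eq_of_le h
  refine ⟨P.withDensity (g ∘ f), ?_, ?_⟩
  · calc P.withDensity (g ∘ f) ≤ P.withDensity 1 :=
          withDensity_mono (Eventually.of_forall fun x => hg1 (f x))
      _ = P := withDensity_one
  · ext A hA
    rw [Measure.map_apply hf hA, withDensity_apply _ (hf hA), withDensity_apply _ hA,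
      setLIntegral_map hA hg hf]
    rfl

theorem exists_le_forall_map_add_le {ι : Type*} [Fintype ι] {P : Measure Ω} [IsFiniteMeasure P]
    {f : ι → Ω → α} (hf : ∀ i, Measurable (f i)) {τ : ι → Measure α}
    (hτ : ∀ i, τ i ≤ P.map (f i)) :
    ∃ Q ≤ P, (∀ i, Q.map (f i) + τ i ≤ P.map (f i)) ∧ P univ ≤ Q univ + ∑ i, τ i univ := by
  classical
  choose τ' hτ' τ'_map using fun i => exists_le_map_eq_of_le_map (hf i) (hτ i)
  have (i : ι) : IsFiniteMeasure (τ' i) := isFiniteMeasure_of_le P (hτ' i)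
  set Q : Measure Ω := P - ∑ i, τ' i
  have Q_add_le : ∀ i, Q + τ' i ≤ P := fun i => calc
    Q + τ' i ≤ (P - τ' i) + τ' i := by
      gcongr
      refine Measure.sub_le_of_le_add ?_
      calc P = (P - τ' i) + τ' i := (Measure.sub_add_cancel_of_le (hτ' i)).symm
        _ ≤ (P - τ' i) + ∑ j, τ' j := by
          gcongr
          rw [← Finset.add_sum_erase _ _ (Finset.mem_univ i)]
          exact Measure.le_add_right le_rfl
    _ = P := Measure.sub_add_cancel_of_le (hτ' i)
  refine ⟨Q, Measure.sub_le, fun i => ?_, ?_⟩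
  · rw [← τ'_map i, ← Measure.map_add _ _ (hf i)]
    exact Measure.map_mono (Q_add_le i) (hf i)
  · have τ'_univ : ∀ i, τ' i univ = τ i univ := fun i => by
      rw [← τ'_map i, Measure.map_apply (hf i) .univ, preimage_univ]
    have : P ≤ Q + ∑ i, τ' i := Measure.sub_le_iff_le_add.1 le_rfl
    simpa [τ'_univ] using this univ

end Subplans

theorem four_mul_smul_add_sub_le {α : Type*} [MeasurableSpace α] {ρ ν : Measure α} {n s : ℝ≥0∞}
    {A : Set α} (hν : ν ≤ ρ) (hA : ρ A ≤ (8 * n)⁻¹) (hs : 8 * n * (ρ - ν) univ ≤ s) :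
    4 * n * (s • ν + (ρ - ν)) A ≤ s := by
  refine (ENNReal.mul_le_mul_iff_right two_ne_zero ENNReal.ofNat_ne_top).1 ?_
  calc 2 * (4 * n * (s • ν + (ρ - ν)) A)
      ≤ 2 * (4 * n * (s * (8 * n)⁻¹ + (ρ - ν) univ)) := by
        rw [Measure.add_apply, Measure.smul_apply, smul_eq_mul]
        gcongr
        · exact (hν A).trans hA
        · exact subset_univ A
    _ = s * (8 * n * (8 * n)⁻¹) + 8 * n * (ρ - ν) univ := by ring
    _ ≤ s * 1 + s := by gcongr; exact ENNReal.mul_inv_le_one _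
    _ = 2 * s := by rw [mul_one, two_mul]

theorem exists_completion_of_marginals_le {ι X : Type*} [Fintype ι] [PseudoMetricSpace X]
    [SecondCountableTopology X] [MeasurableSpace X] [OpensMeasurableSpace X]
    {ρ : Measure X} [IsProbabilityMeasure ρ] {r : ℝ}
    (hρ : ∀ x, ρ (Metric.ball x r) ≤ (8 * Fintype.card ι : ℝ≥0∞)⁻¹)
    {Q : Measure (ι → X)} (hQ : ∀ i, Q.map (fun x => x i) ≤ ρ) {m s : ℝ≥0∞}
    (hm : Q univ + m = 1) (hs : s ≤ 1) (hms : 8 * Fintype.card ι * m ≤ s) :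
    ∃ P S : Measure (ι → X), IsProbabilityMeasure P ∧ (∀ i, P.map (fun x => x i) = ρ) ∧
      P ≤ Q + S ∧ S univ ≤ s + m ∧ ∀ᵐ x ∂S, Pairwise fun i j => r ≤ dist (x i) (x j) := by
  have hmeas := fun i => measurable_pi_apply (X := fun _ : ι => X) i
  have hQ1 : Q univ ≤ 1 := hm ▸ le_self_add
  have : IsFiniteMeasure Q := ⟨hQ1.trans_lt ENNReal.one_lt_top⟩
  have Q_map_univ : ∀ i, Q.map (fun x => x i) univ = Q univ := fun i => by
    rw [Measure.map_apply (hmeas i) .univ, preimage_univ]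
  set σ : ι → Measure X := fun i => ρ - Q.map (fun x => x i) with σ_def
  have σ_add : ∀ i, σ i + Q.map (fun x => x i) = ρ := fun i => Measure.sub_add_cancel_of_le (hQ i)
  have σ_univ : ∀ i, σ i univ = m := fun i => by
    rw [σ_def, Measure.sub_apply .univ (hQ i), Q_map_univ, measure_univ, ← hm,
      ENNReal.add_sub_cancel_left (measure_ne_top Q univ)]
  set M : ℝ≥0∞ := s * Q univ + m with M_def
  have M_le : M ≤ s + m := add_le_add (mul_le_of_le_one_right zero_le hQ1) le_rfl
  have M_ne_top : M ≠ ⊤ :=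
    ((M_le.trans (add_le_add hs (hm ▸ le_add_self))).trans_lt (by simp)).ne
  have s_le : s ≤ M := calc
    s = s * Q univ + s * m := by rw [← mul_add, hm, mul_one]
    _ ≤ M := add_le_add le_rfl (mul_le_of_le_one_left zero_le hs)
  obtain ⟨S, S_univ, S_map, hS⟩ := exists_coupling_pairwise_le_dist
    (η := fun i => s • Q.map (fun x => x i) + σ i) M_ne_top
    (fun i => by simp [Q_map_univ, σ_univ, M_def])
    fun i x => (four_mul_smul_add_sub_le (hQ i) (hρ x) (by rwa [σ_univ i])).trans s_le
  refine ⟨(1 - s) • Q + S, S, ⟨?_⟩, fun i => ?_, ?_, ?_, hS⟩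
  · rw [Measure.add_apply, Measure.smul_apply, smul_eq_mul, S_univ, M_def, ← add_assoc, ← add_mul,
      tsub_add_cancel_of_le hs, one_mul, hm]
  · rw [Measure.map_add _ _ (hmeas i), Measure.map_smul, S_map, ← add_assoc, ← add_smul,
      tsub_add_cancel_of_le hs, one_smul, add_comm, σ_add]
  · gcongr
    refine Measure.le_iff'.2 fun A => ?_
    rw [Measure.smul_apply, smul_eq_mul]
    exact mul_le_of_le_one_left zero_le tsub_le_self
  · exact S_univ ▸ M_le

section Cost

variable {d N : ℕ} {φ : ℝ → ℝ} {r B : ℝ}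

theorem pairCost_le {x y : Space d} (hr : 0 < r) (hB : ∀ t, r ≤ t → φ t ≤ B)
    (h : r ≤ dist x y) : pairCost φ x y ≤ ENNReal.ofReal B := by
  rw [pairCost, if_neg (dist_pos.1 (hr.trans_le h)), ← dist_eq_norm]
  exact ENNReal.ofReal_le_ofReal (hB _ h)

theorem cost_le_of_pairwise_le_dist {x : Fin N → Space d} (hr : 0 < r)
    (hB : ∀ t, r ≤ t → φ t ≤ B) (h : Pairwise fun i j => r ≤ dist (x i) (x j)) :
    cost N φ x ≤ N ^ 2 * ENNReal.ofReal B := calc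
  cost N φ x ≤ ∑ q : Fin N × Fin N with q.1 < q.2, ENNReal.ofReal B :=
      Finset.sum_le_sum fun q hq => pairCost_le hr hB (h (Finset.mem_filter.1 hq).2.ne)
  _ ≤ ∑ _q : Fin N × Fin N, ENNReal.ofReal B :=
      Finset.sum_le_sum_of_subset (Finset.filter_subset _ _)
  _ = N ^ 2 * ENNReal.ofReal B := by simp [sq]

theorem lintegral_cost_le_of_pairwise_le_dist {S : Measure (Fin N → Space d)} (hr : 0 < r)
    (hB : ∀ t, r ≤ t → φ t ≤ B) (hS : ∀ᵐ x ∂S, Pairwise fun i j => r ≤ dist (x i) (x j)) :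
    ∫⁻ x, cost N φ x ∂S ≤ N ^ 2 * ENNReal.ofReal B * S univ := by
  rw [← lintegral_const]
  exact lintegral_mono_ae (hS.mono fun x hx => cost_le_of_pairwise_le_dist hr hB hx)

theorem transportCost_le {ρ : Measure (Space d)} [IsProbabilityMeasure ρ] (hr : 0 < r)
    (hB : ∀ t, r ≤ t → φ t ≤ B) (hρ : ∀ x, ρ (Metric.ball x r) ≤ (4 * N : ℝ≥0∞)⁻¹) :
    transportCost N φ ρ ≤ N ^ 2 * ENNReal.ofReal B := by
  have hball : ∀ (_ : Fin N) x, 4 * (Fintype.card (Fin N) : ℝ≥0∞) * ρ (Metric.ball x r) ≤ 1 := by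
    intro _ x
    rw [Fintype.card_fin]
    exact (mul_le_mul_right (hρ x) _).trans (ENNReal.mul_inv_le_one _)
  obtain ⟨P, P_univ, P_map, hP⟩ :=
    exists_coupling_pairwise_le_dist ENNReal.one_ne_top (fun _ => measure_univ) hball
  calc transportCost N φ ρ ≤ ∫⁻ x, cost N φ x ∂P := iInf₂_le P ⟨⟨P_univ⟩, P_map⟩
    _ ≤ N ^ 2 * ENNReal.ofReal B * P univ := lintegral_cost_le_of_pairwise_le_dist hr hB hP
    _ = N ^ 2 * ENNReal.ofReal B := by rw [P_univ, mul_one]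

theorem exists_mem_plans_lintegral_cost_le {ρ₁ ρ₂ : Measure (Space d)} [IsFiniteMeasure ρ₁]
    [IsProbabilityMeasure ρ₂] (hr : 0 < r) (hB : ∀ t, r ≤ t → φ t ≤ B)
    (hρ : ∀ x, ρ₂ (Metric.ball x r) ≤ (8 * N : ℝ≥0∞)⁻¹)
    (hsmall : 8 * N ^ 2 * (ρ₁ - ρ₂) univ ≤ 1) {P₁ : Measure (Fin N → Space d)}
    (hP₁ : P₁ ∈ plans N ρ₁) :
    ∃ P₂ ∈ plans N ρ₂, ∫⁻ x, cost N φ x ∂P₂ ≤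
      ∫⁻ x, cost N φ x ∂P₁ + 9 * N ^ 4 * ENNReal.ofReal B * (ρ₁ - ρ₂) univ := by
  obtain ⟨_, P₁_map⟩ := hP₁
  set δ : ℝ≥0∞ := (ρ₁ - ρ₂) univ
  obtain ⟨Q, hQP, Q_map, hQ⟩ := exists_le_forall_map_add_le (P := P₁)
    (fun i => measurable_pi_apply (X := fun _ : Fin N => Space d) i) (τ := fun _ => ρ₁ - ρ₂)
    fun i => by rw [P₁_map i]; exact Measure.sub_le
  have Q_map_le : ∀ i, Q.map (fun x => x i) ≤ ρ₂ := fun i =>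
    Measure.le_of_add_le_add_left (μ := ρ₁ - ρ₂) <| by
      rw [add_comm]
      exact (Q_map i).trans ((P₁_map i).le.trans (Measure.sub_le_iff_le_add.1 le_rfl))
  have missing_le : 1 - Q univ ≤ N * δ := by
    rw [tsub_le_iff_left]
    simpa [δ] using hQ
  have excess_le : 8 * N ^ 2 * δ + (1 - Q univ) ≤ 9 * N ^ 2 * δ := calc
    8 * N ^ 2 * δ + (1 - Q univ) ≤ 8 * N ^ 2 * δ + N ^ 2 * δ := by
        gcongr
        refine missing_le.trans ?_
        gcongr
        exact_mod_cast Nat.le_self_pow two_ne_zero N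
    _ = 9 * N ^ 2 * δ := by ring
  obtain ⟨P₂, S, hP₂, P₂_map, hP₂S, S_univ, hS⟩ := exists_completion_of_marginals_le
    (by simpa using hρ) Q_map_le (m := 1 - Q univ)
    (add_tsub_cancel_of_le ((hQP univ).trans_eq measure_univ)) hsmall (by
      rw [Fintype.card_fin, sq, ← mul_assoc, mul_assoc (8 * (N : ℝ≥0∞))]
      gcongr)
  refine ⟨P₂, ⟨hP₂, P₂_map⟩, ?_⟩
  calc ∫⁻ x, cost N φ x ∂P₂
      ≤ ∫⁻ x, cost N φ x ∂Q + ∫⁻ x, cost N φ x ∂S := by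
        rw [← lintegral_add_measure]
        exact lintegral_mono' hP₂S le_rfl
    _ ≤ ∫⁻ x, cost N φ x ∂P₁ + N ^ 2 * ENNReal.ofReal B * (9 * N ^ 2 * δ) := by
        gcongr
        exact (lintegral_cost_le_of_pairwise_le_dist hr hB hS).trans
          (mul_le_mul_right (S_univ.trans excess_le) _)
    _ = ∫⁻ x, cost N φ x ∂P₁ + 9 * N ^ 4 * ENNReal.ofReal B * δ := by ring

theorem transportCost_le_add {ρ₁ ρ₂ : Measure (Space d)} [IsFiniteMeasure ρ₁]
    [IsProbabilityMeasure ρ₂] (hr : 0 < r) (hB : ∀ t, r ≤ t → φ t ≤ B)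
    (hρ : ∀ x, ρ₂ (Metric.ball x r) ≤ (8 * N : ℝ≥0∞)⁻¹) :
    transportCost N φ ρ₂ ≤
      transportCost N φ ρ₁ + 9 * N ^ 4 * ENNReal.ofReal B * (ρ₁ - ρ₂) univ := by
  rcases le_total (8 * N ^ 2 * (ρ₁ - ρ₂) univ) 1 with hsmall | hlarge
  · conv_rhs => rw [transportCost]
    simp only [ENNReal.iInf_add]
    refine le_iInf₂ fun P₁ hP₁ => ?_
    obtain ⟨P₂, hP₂, h⟩ := exists_mem_plans_lintegral_cost_le hr hB hρ hsmall hP₁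
    exact (iInf₂_le P₂ hP₂).trans h
  · have hρ' : ∀ x, ρ₂ (Metric.ball x r) ≤ (4 * N : ℝ≥0∞)⁻¹ := fun x =>
      (hρ x).trans (by gcongr; norm_num)
    calc transportCost N φ ρ₂ ≤ N ^ 2 * ENNReal.ofReal B := transportCost_le hr hB hρ'
      _ ≤ N ^ 2 * ENNReal.ofReal B * (8 * N ^ 2 * (ρ₁ - ρ₂) univ) := le_mul_of_one_le_right' hlarge
      _ = 8 * N ^ 4 * ENNReal.ofReal B * (ρ₁ - ρ₂) univ := by ring
      _ ≤ 9 * N ^ 4 * ENNReal.ofReal B * (ρ₁ - ρ₂) univ := by gcongr; norm_num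
      _ ≤ transportCost N φ ρ₁ + 9 * N ^ 4 * ENNReal.ofReal B * (ρ₁ - ρ₂) univ := le_add_self

end Cost

section Densities

variable {d N : ℕ} {φ : ℝ → ℝ} {r B : ℝ}

theorem isProbabilityMeasure_densityMeasure {ρ : Lp ℝ 1 (volume : Measure (Space d))}
    (hρ : ρ ∈ probDensities d) : IsProbabilityMeasure (densityMeasure ρ) := by
  refine ⟨?_⟩
  rw [densityMeasure, withDensity_apply _ .univ, setLIntegral_univ,
    ← ofReal_integral_eq_lintegral_ofReal (L1.integrable_coeFn ρ) ((Lp.coeFn_nonneg ρ).2 hρ.1),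
    hρ.2, ENNReal.ofReal_one]

theorem densityMeasure_sub_univ_le_edist (ρ₁ ρ₂ : Lp ℝ 1 (volume : Measure (Space d))) :
    (densityMeasure ρ₁ - densityMeasure ρ₂) univ ≤ edist ρ₁ ρ₂ := by
  have density_le : ∀ x, ENNReal.ofReal (ρ₁ x) ≤ ‖ρ₁ x - ρ₂ x‖ₑ + ENNReal.ofReal (ρ₂ x) := by
    intro x
    rw [Real.enorm_eq_ofReal_abs]
    refine (ENNReal.ofReal_le_ofReal ?_).trans ENNReal.ofReal_add_le
    linarith [le_abs_self (ρ₁ x - ρ₂ x)]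
  have measure_le : densityMeasure ρ₁ ≤
      volume.withDensity (fun x => ‖ρ₁ x - ρ₂ x‖ₑ) + densityMeasure ρ₂ := by
    rw [densityMeasure, densityMeasure,
      ← withDensity_add_right _ (Lp.stronglyMeasurable ρ₂).measurable.ennreal_ofReal]
    exact withDensity_mono (Eventually.of_forall density_le)
  calc (densityMeasure ρ₁ - densityMeasure ρ₂) univ
      ≤ volume.withDensity (fun x => ‖ρ₁ x - ρ₂ x‖ₑ) univ :=
        Measure.sub_le_of_le_add measure_le univ
    _ = edist ρ₁ ρ₂ := by
        rw [withDensity_apply _ .univ, setLIntegral_univ, Lp.edist_def,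
          eLpNorm_one_eq_lintegral_enorm]
        rfl

theorem lipschitzOnWith_densityCost {S : Set (Lp ℝ 1 (volume : Measure (Space d)))}
    (hS : S ⊆ probDensities d) (hr : 0 < r) (hB : ∀ t, r ≤ t → φ t ≤ B)
    (hball : ∀ ρ ∈ S, ∀ x, densityMeasure ρ (Metric.ball x r) ≤ (8 * N : ℝ≥0∞)⁻¹)
    (hfin : ∀ ρ ∈ S, densityCost N φ ρ ≠ ⊤) :
    LipschitzOnWith (9 * N ^ 4 * B.toNNReal) (fun ρ => (densityCost N φ ρ).toReal) S := by
  refine LipschitzOnWith.of_le_add_mul _ fun ρ₂ h₂ ρ₁ h₁ => ?_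
  have := isProbabilityMeasure_densityMeasure (hS h₁)
  have := isProbabilityMeasure_densityMeasure (hS h₂)
  have cost_le : densityCost N φ ρ₂ ≤
      densityCost N φ ρ₁ + (9 * N ^ 4 * B.toNNReal : ℝ≥0) * edist ρ₁ ρ₂ := by
    push_cast
    exact (transportCost_le_add hr hB (hball ρ₂ h₂)).trans
      (add_le_add_right (mul_le_mul_right (densityMeasure_sub_univ_le_edist ρ₁ ρ₂) _) _)
  have hedist : ((9 * N ^ 4 * B.toNNReal : ℝ≥0) * edist ρ₁ ρ₂ : ℝ≥0∞) ≠ ⊤ :=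
    ENNReal.mul_ne_top ENNReal.coe_ne_top (edist_ne_top _ _)
  have := ENNReal.toReal_mono (ENNReal.add_ne_top.2 ⟨hfin ρ₁ h₁, hedist⟩) cost_le
  rwa [ENNReal.toReal_add (hfin ρ₁ h₁) hedist, ENNReal.toReal_mul, edist_comm,
    ← dist_edist] at this

/-- The measures in `𝓜` give uniformly small mass to small balls: their Lévy concentration functions
`r ↦ sup_x μ(B(x, r))` tend to `0` uniformly as `r → 0`. -/
def UniformlyNonconcentrated {X : Type*} [PseudoMetricSpace X] [MeasurableSpace X]
    (𝓜 : Set (Measure X)) : Prop :=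
  ∀ ε : ℝ≥0∞, ε ≠ 0 → ∃ r : ℝ, 0 < r ∧ ∀ μ ∈ 𝓜, ∀ x, μ (Metric.ball x r) ≤ ε

theorem UniformlyNonconcentrated.exists_lipschitzOnWith_densityCost
    {S : Set (Lp ℝ 1 (volume : Measure (Space d)))}
    (hS : UniformlyNonconcentrated (densityMeasure '' S)) (hS' : S ⊆ probDensities d)
    (hφ : ∀ r, 0 < r → BddAbove (φ '' Ici r)) (N : ℕ) :
    (∀ ρ ∈ S, densityCost N φ ρ ≠ ⊤) ∧
      ∃ K : ℝ≥0, LipschitzOnWith K (fun ρ => (densityCost N φ ρ).toReal) S := by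
  obtain ⟨r, hr, hball⟩ := hS (8 * N : ℝ≥0∞)⁻¹ (ENNReal.inv_ne_zero.2 (by finiteness))
  rw [forall_mem_image] at hball
  obtain ⟨B, hB⟩ := hφ r hr
  have hB : ∀ t, r ≤ t → φ t ≤ B := fun t ht => hB (mem_image_of_mem φ ht)
  have hfin : ∀ ρ ∈ S, densityCost N φ ρ ≠ ⊤ := fun ρ hρ => by
    have := isProbabilityMeasure_densityMeasure (hS' hρ)
    exact ((transportCost_le hr hB fun x =>
      (hball hρ x).trans (by gcongr; norm_num)).trans_lt (by finiteness)).ne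
  exact ⟨hfin, _, lipschitzOnWith_densityCost hS' hr hB (fun _ hρ => hball hρ) hfin⟩

end Densities

theorem setLIntegral_enorm_le_eLpNorm_mul_rpow_measure {α E : Type*} [MeasurableSpace α]
    {μ : Measure α} [NormedAddCommGroup E] {f : α → E} (hf : AEStronglyMeasurable f μ)
    {p : ℝ≥0∞} (hp : 1 ≤ p) (A : Set α) :
    ∫⁻ x in A, ‖f x‖ₑ ∂μ ≤ eLpNorm f p μ * μ A ^ (1 - p.toReal⁻¹) := by
  have holder := eLpNorm_le_eLpNorm_mul_rpow_measure_univ hp (hf.restrict (s := A))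
  rw [eLpNorm_one_eq_lintegral_enorm, Measure.restrict_apply_univ, ENNReal.toReal_one, one_div_one,
    one_div] at holder
  exact holder.trans (by gcongr; exact Measure.restrict_le_self)

theorem one_sub_inv_toReal_pos {p : ℝ≥0∞} (hp : 1 < p) : 0 < 1 - p.toReal⁻¹ := by
  rw [← ENNReal.toReal_inv, sub_pos, ← ENNReal.toReal_one]
  exact ENNReal.toReal_strict_mono ENNReal.one_ne_top (ENNReal.inv_lt_one.2 hp)

theorem tendsto_volume_ball_zero {d : ℕ} (hd : 0 < d) :
    Tendsto (fun r => volume (Metric.ball (0 : Space d) r)) (𝓝[>] 0) (𝓝 0) := by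
  have : NeZero d := ⟨hd.ne'⟩
  simpa only [Metric.thickening_singleton, measure_singleton] using
    tendsto_measure_thickening_of_isClosed (μ := volume)
      ⟨1, one_pos, by simpa only [Metric.thickening_singleton] using measure_ball_lt_top.ne⟩
      (isClosed_singleton (x := (0 : Space d)))

theorem uniformlyNonconcentrated_of_eLpNorm_le {d : ℕ} (hd : 0 < d) {p : ℝ≥0∞} (hp : 1 < p)
    {M : ℝ≥0} {S : Set (Lp ℝ 1 (volume : Measure (Space d)))}
    (hS : ∀ ρ ∈ S, eLpNorm ρ p volume ≤ M) :
    UniformlyNonconcentrated (densityMeasure '' S) := by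
  intro ε hε
  have hlim : Tendsto (fun r => M * volume (Metric.ball (0 : Space d) r) ^ (1 - p.toReal⁻¹))
      (𝓝[>] 0) (𝓝 0) := by
    have hpow := (tendsto_volume_ball_zero hd).ennrpow_const (1 - p.toReal⁻¹)
    rw [ENNReal.zero_rpow_of_pos (one_sub_inv_toReal_pos hp)] at hpow
    simpa only [mul_zero] using ENNReal.Tendsto.const_mul hpow (Or.inr ENNReal.coe_ne_top)
  obtain ⟨r, hrε, hr⟩ :=
    ((hlim.eventually_le_const (pos_iff_ne_zero.2 hε)).and self_mem_nhdsWithin).exists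
  refine ⟨r, hr, forall_mem_image.2 fun ρ hρ x => ?_⟩
  calc densityMeasure ρ (Metric.ball x r)
      = ∫⁻ y in Metric.ball x r, ENNReal.ofReal (ρ y) :=
        withDensity_apply _ Metric.isOpen_ball.measurableSet
    _ ≤ ∫⁻ y in Metric.ball x r, ‖ρ y‖ₑ := lintegral_mono fun y => Real.ofReal_le_enorm _
    _ ≤ eLpNorm ρ p volume * volume (Metric.ball x r) ^ (1 - p.toReal⁻¹) :=
        setLIntegral_enorm_le_eLpNorm_mul_rpow_measure (Lp.aestronglyMeasurable ρ) hp.le _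
    _ ≤ M * volume (Metric.ball (0 : Space d) r) ^ (1 - p.toReal⁻¹) := by
        rw [Measure.addHaar_ball_center]
        gcongr
        exact hS ρ hρ
    _ ≤ ε := hrε

section Translation

theorem norm_integral_mul_inner_le {α E : Type*} [MeasurableSpace α] {μ : Measure α}
    [NormedAddCommGroup E] [InnerProductSpace ℝ E] {f : α → ℝ} {G : α → E}
    (hf : MemLp f 2 μ) (hG : MemLp G 2 μ) (v : E) :
    ‖∫ x, f x * inner ℝ (G x) v ∂μ‖ ≤
      ‖v‖ * (eLpNorm G 2 μ).toReal * (eLpNorm f 2 μ).toReal := by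
  have pointwise : ∀ x, ‖f x * inner ℝ (G x) v‖₊ ≤ ‖v‖₊ * ‖f x‖₊ * ‖G x‖₊ := fun x => by
    rw [nnnorm_mul, mul_comm ‖v‖₊, mul_assoc, mul_comm ‖v‖₊]
    gcongr
    exact nnnorm_inner_le_nnnorm _ _
  have holder : ‖∫ x, f x * inner ℝ (G x) v ∂μ‖ₑ ≤ ‖v‖ₑ * eLpNorm f 2 μ * eLpNorm G 2 μ := by
    refine (enorm_integral_le_lintegral_enorm _).trans ?_
    rw [← eLpNorm_one_eq_lintegral_enorm]
    exact eLpNorm_le_eLpNorm_mul_eLpNorm_of_nnnorm hf.1 hG.1 (fun a y => a * inner ℝ y v) ‖v‖₊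
      (Eventually.of_forall pointwise)
  have hfin : ‖v‖ₑ * eLpNorm f 2 μ * eLpNorm G 2 μ ≠ ⊤ :=
    ENNReal.mul_ne_top (ENNReal.mul_ne_top enorm_ne_top hf.2.ne) hG.2.ne
  simpa only [ENNReal.toReal_mul, toReal_enorm, mul_right_comm] using
    ENNReal.toReal_mono hfin holder

open scoped Convolution in
theorem hasDerivAt_integral_mul_comp_sub_smul {d : ℕ} {u ψ : Space d → ℝ}
    (hu : LocallyIntegrable u volume) (hψ : ContDiff ℝ 1 ψ) (hψc : HasCompactSupport ψ)
    (h : Space d) (t : ℝ) :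
    HasDerivAt (fun t : ℝ => ∫ x, u x * ψ (x - t • h))
      (-∫ x, u x * fderiv ℝ ψ (x - t • h) h) t := by
  set L := ContinuousLinearMap.mul ℝ ℝ
  set χ : Space d → ℝ := fun y => ψ (-y)
  have hχ : ContDiff ℝ 1 χ := hψ.comp contDiff_neg
  have hχc : HasCompactSupport χ := hψc.comp_homeomorph (Homeomorph.neg _)
  have conv_eq : ∀ z, (u ⋆[L, volume] χ) z = ∫ x, u x * ψ (x - z) := fun z => by
    simp [convolution_def, L, χ]
  have fderiv_χ : ∀ y, fderiv ℝ χ y h = -fderiv ℝ ψ (-y) h := fun y => by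
    simpa using DFunLike.congr_fun (fderiv_comp_smul (f := ψ) (x := y) (-1 : ℝ)) h
  have deriv_eq : (u ⋆[L.precompR (Space d), volume] fderiv ℝ χ) (t • h) h =
      -∫ x, u x * fderiv ℝ ψ (x - t • h) h := by
    rw [convolution_precompR_apply L hu (hχc.fderiv ℝ) (hχ.continuous_fderiv one_ne_zero),
      convolution_def, ← integral_neg]
    simp only [fderiv_χ, neg_sub, L, ContinuousLinearMap.mul_apply', mul_neg]
  simp only [← conv_eq, ← deriv_eq]
  have hline : HasDerivAt (fun t : ℝ => t • h) h t := by
    simpa using (hasDerivAt_id t).smul_const h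
  exact (hχc.hasFDerivAt_convolution_right L hu hχ (t • h)).comp_hasDerivAt t hline

variable {d : ℕ} {u : Space d → ℝ} {G : Space d → Space d}

theorem IsWeakGradient.hasDerivAt_integral_mul_comp_sub_smul (hG : IsWeakGradient u G)
    {ψ : Space d → ℝ} (hψ : ContDiff ℝ ∞ ψ) (hψc : HasCompactSupport ψ) (h : Space d) (t : ℝ) :
    HasDerivAt (fun t : ℝ => ∫ x, u x * ψ (x - t • h))
      (∫ x, ψ (x - t • h) * inner ℝ (G x) h) t := by
  have hshift : ContDiff ℝ ∞ fun x => ψ (x - t • h) := hψ.comp (contDiff_id.sub contDiff_const)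
  have hshiftc : HasCompactSupport fun x => ψ (x - t • h) :=
    hψc.comp_homeomorph (Homeomorph.subRight (t • h))
  have parts := hG.integral_eq _ hshift hshiftc h
  simp only [fderiv_comp_sub] at parts
  rw [← neg_eq_iff_eq_neg.2 parts]
  exact RepulsiveTransport.hasDerivAt_integral_mul_comp_sub_smul hG.locallyIntegrable
    (hψ.of_le (by norm_cast)) hψc h t

theorem IsWeakGradient.norm_integral_mul_comp_sub_sub_le (hG : IsWeakGradient u G)
    (hG2 : MemLp G 2 volume) {ψ : Space d → ℝ} (hψ : ContDiff ℝ ∞ ψ) (hψc : HasCompactSupport ψ)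
    (h : Space d) :
    ‖(∫ x, u x * ψ (x - h)) - ∫ x, u x * ψ x‖ ≤
      ‖h‖ * (eLpNorm G 2 volume).toReal * (eLpNorm ψ 2 volume).toReal := by
  have deriv_le : ∀ t : ℝ, ‖∫ x, ψ (x - t • h) * inner ℝ (G x) h‖ ≤
      ‖h‖ * (eLpNorm G 2 volume).toReal * (eLpNorm ψ 2 volume).toReal := fun t => by
    have hmp := measurePreserving_sub_right (volume : Measure (Space d)) (t • h)
    rw [← eLpNorm_comp_measurePreserving hψ.continuous.aestronglyMeasurable hmp]
    exact norm_integral_mul_inner_le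
      ((hψ.continuous.memLp_of_hasCompactSupport hψc).comp_measurePreserving hmp) hG2 h
  simpa using convex_univ.norm_image_sub_le_of_norm_hasDerivWithin_le
    (fun t _ => (hG.hasDerivAt_integral_mul_comp_sub_smul hψ hψc h t).hasDerivWithinAt)
    (fun t _ => deriv_le t) (mem_univ (0 : ℝ)) (mem_univ 1)

theorem eLpNorm_two_le_of_forall_contDiff {E : Type*} [NormedAddCommGroup E] [NormedSpace ℝ E]
    [FiniteDimensional ℝ E] [MeasurableSpace E] [BorelSpace E] {μ : Measure E}
    [IsFiniteMeasureOnCompacts μ] {f : E → ℝ} (hf : MemLp f 2 μ) {C : ℝ}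
    (hC : ∀ ψ : E → ℝ, ContDiff ℝ ∞ ψ → HasCompactSupport ψ →
      ‖∫ x, f x * ψ x ∂μ‖ ≤ C * (eLpNorm ψ 2 μ).toReal) :
    eLpNorm f 2 μ ≤ ENNReal.ofReal C := by
  have pairing_le : ∀ g : Lp ℝ 2 μ, ‖inner ℝ g hf.toLp‖ ≤ C * ‖g‖ := fun g => by
    refine (Lp.dense_hasCompactSupport_contDiff (F := ℝ) (μ := μ) (p := 2) (by simp)).induction
      (P := fun g => ‖inner ℝ g hf.toLp‖ ≤ C * ‖g‖) ?_
      (isClosed_le (by fun_prop) (by fun_prop)) g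
    rintro g ⟨ψ, hgψ, hψc, hψ⟩
    have inner_eq : inner ℝ g hf.toLp = ∫ x, f x * ψ x ∂μ := by
      rw [L2.inner_def]
      refine integral_congr_ae ?_
      filter_upwards [hgψ, hf.coeFn_toLp] with x hg hf
      rw [hg, hf]
      rfl
    rw [inner_eq, Lp.norm_def, eLpNorm_congr_ae hgψ]
    exact hC ψ hψ hψc
  have self_pairing := pairing_le hf.toLp
  rw [real_inner_self_eq_norm_sq, Real.norm_of_nonneg (sq_nonneg _), sq] at self_pairing
  rw [← ENNReal.ofReal_toReal hf.2.ne, ← Lp.norm_toLp f hf]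
  rcases (norm_nonneg (hf.toLp f)).eq_or_lt with hzero | hpos
  · rw [← hzero, ENNReal.ofReal_zero]
    exact zero_le
  · exact ENNReal.ofReal_le_ofReal (le_of_mul_le_mul_right self_pairing hpos)

theorem IsWeakGradient.eLpNorm_comp_add_sub_le (hG : IsWeakGradient u G) (hu : MemLp u 2 volume)
    (hG2 : MemLp G 2 volume) (h : Space d) :
    eLpNorm (fun x => u (x + h) - u x) 2 volume ≤ ‖h‖ₑ * eLpNorm G 2 volume := by
  have hut : MemLp (fun x => u (x + h)) 2 volume :=
    hu.comp_measurePreserving (measurePreserving_add_right volume h)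
  have pairing_le : ∀ ψ : Space d → ℝ, ContDiff ℝ ∞ ψ → HasCompactSupport ψ →
      ‖∫ x, (u (x + h) - u x) * ψ x‖ ≤
        ‖h‖ * (eLpNorm G 2 volume).toReal * (eLpNorm ψ 2 volume).toReal := by
    intro ψ hψ hψc
    have hψ2 : MemLp ψ 2 volume := hψ.continuous.memLp_of_hasCompactSupport hψc
    have translate : ∫ x, u (x + h) * ψ x = ∫ x, u x * ψ (x - h) := by
      rw [← integral_add_right_eq_self (fun x => u x * ψ (x - h)) h]
      simp only [add_sub_cancel_right]
    have split : ∫ x, (u (x + h) - u x) * ψ x = (∫ x, u (x + h) * ψ x) - ∫ x, u x * ψ x := by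
      simp only [sub_mul]
      exact integral_sub (hut.integrable_mul hψ2) (hu.integrable_mul hψ2)
    rw [split, translate]
    exact hG.norm_integral_mul_comp_sub_sub_le hG2 hψ hψc h
  refine (eLpNorm_two_le_of_forall_contDiff (hut.sub hu) pairing_le).trans_eq ?_
  rw [ENNReal.ofReal_mul (norm_nonneg h), ofReal_norm, ENNReal.ofReal_toReal hG2.2.ne]

end Translation

section SobolevBound

theorem exists_norm_le_measure_ball_add_le {E : Type*} [NormedAddCommGroup E] [NormedSpace ℝ E]
    [Nontrivial E] [MeasurableSpace E] [OpensMeasurableSpace E] (μ : Measure E)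
    [IsProbabilityMeasure μ] (x : E) {r : ℝ} (hr : 0 < r) {n : ℕ} (hn : n ≠ 0) :
    ∃ v : E, ‖v‖ ≤ 2 * r * n ∧ μ (Metric.ball (x + v) r) ≤ (n : ℝ≥0∞)⁻¹ := by
  obtain ⟨e, he⟩ := exists_norm_eq E zero_le_one
  let v : ℕ → E := fun i => (2 * r * i) • e
  have norm_v : ∀ i, ‖v i‖ = 2 * r * i := fun i => by
    rw [norm_smul, he, mul_one, Real.norm_of_nonneg (by positivity)]
  have disjoint : Pairwise fun i j =>
      Disjoint (Metric.ball (x + v i) r) (Metric.ball (x + v j) r) := fun i j hij => by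
    refine Metric.ball_disjoint_ball ?_
    have one_le : (1 : ℝ) ≤ |(i : ℝ) - j| := by
      exact_mod_cast Int.one_le_abs (sub_ne_zero.2 (Nat.cast_injective.ne hij : (i : ℤ) ≠ j))
    rw [dist_add_left, dist_eq_norm, ← sub_smul, norm_smul, he, mul_one, ← mul_sub, norm_mul,
      Real.norm_of_nonneg (by positivity), Real.norm_eq_abs]
    nlinarith
  have sum_le : ∑ i ∈ Finset.range n, μ (Metric.ball (x + v i) r) ≤
      ∑ _i ∈ Finset.range n, (n : ℝ≥0∞)⁻¹ := by
    rw [Finset.sum_const, Finset.card_range, nsmul_eq_mul,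
      ENNReal.mul_inv_cancel (Nat.cast_ne_zero.2 hn) (ENNReal.natCast_ne_top n),
      ← measure_biUnion_finset (disjoint.set_pairwise _) fun _ _ =>
        Metric.isOpen_ball.measurableSet]
    exact prob_le_one
  obtain ⟨i, hi, hle⟩ : ∃ i ∈ Finset.range n, μ (Metric.ball (x + v i) r) ≤ (n : ℝ≥0∞)⁻¹ := by
    by_contra! hlt
    exact (ENNReal.sum_lt_sum_of_nonempty (Finset.nonempty_range_iff.2 hn) hlt).not_ge sum_le
  refine ⟨v i, (norm_v i).trans_le ?_, hle⟩
  have : (i : ℝ) ≤ n := by exact_mod_cast (Finset.mem_range.1 hi).le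
  gcongr

theorem eLpNorm_restrict_ball_le_add {E F : Type*} [NormedAddCommGroup E] [MeasurableSpace E]
    [BorelSpace E] [NormedAddCommGroup F] {μ : Measure E} [μ.IsAddRightInvariant] {u : E → F}
    (hu : AEStronglyMeasurable u μ) {p : ℝ≥0∞} (hp : 1 ≤ p) (x v : E) (r : ℝ) :
    eLpNorm u p (μ.restrict (Metric.ball x r)) ≤
      eLpNorm u p (μ.restrict (Metric.ball (x + v) r)) +
        eLpNorm (fun y => u (y + v) - u y) p μ := by
  have hmp := measurePreserving_add_right μ v
  have hut : AEStronglyMeasurable (fun y => u (y + v)) μ := hu.comp_measurePreserving hmp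
  have hmp_ball : MeasurePreserving (· + v) (μ.restrict (Metric.ball x r))
      (μ.restrict (Metric.ball (x + v) r)) := by
    convert hmp.restrict_preimage Metric.isOpen_ball.measurableSet using 2
    ext y
    simp
  calc eLpNorm u p (μ.restrict (Metric.ball x r))
      = eLpNorm ((fun y => u (y + v)) - fun y => u (y + v) - u y) p
          (μ.restrict (Metric.ball x r)) := by
        congr 1
        funext y
        simp
    _ ≤ eLpNorm (u ∘ (· + v)) p (μ.restrict (Metric.ball x r)) +
          eLpNorm (fun y => u (y + v) - u y) p (μ.restrict (Metric.ball x r)) :=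
        eLpNorm_sub_le hut.restrict (hut.sub hu).restrict hp
    _ ≤ _ := by
        rw [eLpNorm_comp_measurePreserving hu.restrict hmp_ball]
        gcongr
        exact Measure.restrict_le_self

variable {d : ℕ}

theorem densityMeasure_eq_eLpNorm_sqrt_sq {ρ : Lp ℝ 1 (volume : Measure (Space d))}
    (hρ : 0 ≤ ρ) {A : Set (Space d)} (hA : MeasurableSet A) :
    densityMeasure ρ A = eLpNorm (fun x => √(ρ x)) 2 (volume.restrict A) ^ 2 := by
  have sq_eq := eLpNorm_nnreal_pow_eq_lintegral (f := fun x => √(ρ x)) (p := 2)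
    (μ := volume.restrict A) two_ne_zero
  simp only [ENNReal.coe_ofNat, NNReal.coe_ofNat, ENNReal.rpow_ofNat] at sq_eq
  rw [densityMeasure, withDensity_apply _ hA, sq_eq]
  refine lintegral_congr_ae (ae_restrict_of_ae ?_)
  filter_upwards [(Lp.coeFn_nonneg ρ).2 hρ] with x hx
  rw [Real.enorm_of_nonneg (Real.sqrt_nonneg _), ← ENNReal.ofReal_pow (Real.sqrt_nonneg _),
    Real.sq_sqrt hx]

theorem memLp_sqrt {ρ : Lp ℝ 1 (volume : Measure (Space d))} (hρ : 0 ≤ ρ) :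
    MemLp (fun x => √(ρ x)) 2 volume := by
  have hmeas : AEStronglyMeasurable (fun x => √(ρ x)) volume :=
    Real.continuous_sqrt.comp_aestronglyMeasurable (Lp.aestronglyMeasurable ρ)
  refine (memLp_two_iff_integrable_sq hmeas).2 ((L1.integrable_coeFn ρ).congr ?_)
  filter_upwards [(Lp.coeFn_nonneg ρ).2 hρ] with x hx
  exact (Real.sq_sqrt hx).symm

theorem densityMeasure_ball_le (hd : 0 < d) {ρ : Lp ℝ 1 (volume : Measure (Space d))}
    (hρ : ρ ∈ probDensities d) {G : Space d → Space d}
    (hG : IsWeakGradient (fun x => √(ρ x)) G) (hG2 : MemLp G 2 volume) {r : ℝ} (hr : 0 < r)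
    {k : ℕ} (hk : k ≠ 0) (x : Space d) :
    densityMeasure ρ (Metric.ball x r) ≤
      ((k : ℝ≥0∞)⁻¹ + ENNReal.ofReal (2 * r * k ^ 2) * eLpNorm G 2 volume) ^ 2 := by
  have : NeZero d := ⟨hd.ne'⟩
  have := isProbabilityMeasure_densityMeasure hρ
  obtain ⟨v, hv, hball⟩ :=
    exists_norm_le_measure_ball_add_le (densityMeasure ρ) x hr (pow_ne_zero 2 hk)
  rw [densityMeasure_eq_eLpNorm_sqrt_sq hρ.1 Metric.isOpen_ball.measurableSet, Nat.cast_pow,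
    ENNReal.inv_pow, ENNReal.pow_le_pow_left_iff two_ne_zero] at hball
  rw [densityMeasure_eq_eLpNorm_sqrt_sq hρ.1 Metric.isOpen_ball.measurableSet]
  refine pow_le_pow_left₀ zero_le ?_ 2
  refine (eLpNorm_restrict_ball_le_add (memLp_sqrt hρ.1).1 one_le_two x v r).trans ?_
  refine add_le_add hball ((hG.eLpNorm_comp_add_sub_le (memLp_sqrt hρ.1) hG2 v).trans ?_)
  rw [← ofReal_norm]
  gcongr
  exact_mod_cast hv

theorem exists_isWeakGradient_of_eH1Norm_lt {u : Space d → ℝ} {M : ℝ≥0} (h : eH1Norm u < M) :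
    ∃ G, IsWeakGradient u G ∧ MemLp G 2 volume ∧ eLpNorm G 2 volume ≤ M := by
  simp only [eH1Norm, iInf_lt_iff] at h
  obtain ⟨G, hG, hlt⟩ := h
  have hle : eLpNorm G 2 volume ≤ M := by
    refine le_trans ?_ hlt.le
    calc eLpNorm G 2 volume = (eLpNorm G 2 volume ^ 2) ^ (1 / 2 : ℝ) := by
          rw [← ENNReal.rpow_natCast, ← ENNReal.rpow_mul]
          norm_num
      _ ≤ (eLpNorm u 2 volume ^ 2 + eLpNorm G 2 volume ^ 2) ^ (1 / 2 : ℝ) := by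
          gcongr
          exact le_add_self
  exact ⟨G, hG, ⟨hG.locallyIntegrable_grad.aestronglyMeasurable,
    hle.trans_lt ENNReal.coe_lt_top⟩, hle⟩

theorem uniformlyNonconcentrated_of_eH1Norm_sqrt_le (hd : 0 < d) {M : ℝ≥0}
    {S : Set (Lp ℝ 1 (volume : Measure (Space d)))} (hS : S ⊆ probDensities d)
    (hM : ∀ ρ ∈ S, eH1Norm (fun x => √(ρ x)) ≤ M) :
    UniformlyNonconcentrated (densityMeasure '' S) := by
  intro ε hε
  have hlim : Tendsto (fun k : ℕ =>
      ((k : ℝ≥0∞)⁻¹ + ENNReal.ofReal (2 * (k : ℝ)⁻¹) * (M + 1 : ℝ≥0)) ^ 2) atTop (𝓝 0) := by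
    have hofReal : Tendsto (fun k : ℕ => ENNReal.ofReal (2 * (k : ℝ)⁻¹)) atTop (𝓝 0) := by
      simpa using ENNReal.tendsto_ofReal (tendsto_inv_atTop_nhds_zero_nat (𝕜 := ℝ).const_mul 2)
    simpa using ENNReal.Tendsto.pow (n := 2) (ENNReal.tendsto_inv_nat_nhds_zero.add
      (ENNReal.Tendsto.mul_const hofReal (Or.inr (ENNReal.coe_ne_top (r := M + 1)))))
  obtain ⟨k, hkε, hk⟩ :=
    ((hlim.eventually_le_const (pos_iff_ne_zero.2 hε)).and (eventually_ne_atTop 0)).exists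
  have hk0 : (k : ℝ) ≠ 0 := Nat.cast_ne_zero.2 hk
  refine ⟨((k : ℝ) ^ 3)⁻¹, by positivity, forall_mem_image.2 fun ρ hρ x => ?_⟩
  obtain ⟨G, hG, hG2, hGM⟩ := exists_isWeakGradient_of_eH1Norm_lt
    ((hM ρ hρ).trans_lt (ENNReal.coe_lt_coe.2 (lt_add_one M)))
  refine (densityMeasure_ball_le hd (hS hρ) hG hG2 (by positivity) hk x).trans (le_trans ?_ hkε)
  rw [show 2 * ((k : ℝ) ^ 3)⁻¹ * k ^ 2 = 2 * (k : ℝ)⁻¹ by field_simp]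
  gcongr

end SobolevBound

theorem IsRepulsivePotential.exists_mapsTo_Icc {φ : ℝ → ℝ} (hφ : IsRepulsivePotential φ)
    {r : ℝ} (hr : 0 < r) : ∃ B, MapsTo φ (Ici r) (Icc 0 B) :=
  ⟨φ r, fun _ ht => ⟨hφ.nonneg _ (hr.trans_le ht),
    hφ.strictAntiOn.antitoneOn hr (hr.trans_le ht) ht⟩⟩

end RepulsiveTransport

open RepulsiveTransport in
theorem mainTheorem8_general (N : ℕ) {φ : ℝ → ℝ}
    (hφ : ∀ r, 0 < r → ∃ B, MapsTo φ (Ici r) (Icc 0 B)) {d : ℕ} (hd : 0 < d)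
    {S : Set (Lp ℝ 1 (volume : Measure (Space d)))} (hS : S ⊆ probDensities d)
    (hbound : (∃ p : ℝ≥0∞, 1 < p ∧ ∃ M : ℝ≥0, ∀ ρ ∈ S, eLpNorm ρ p volume ≤ M) ∨
      ∃ M : ℝ≥0, ∀ ρ ∈ S, eH1Norm (fun x => √(ρ x)) ≤ M) :
    (∀ ρ ∈ S, densityCost N φ ρ ≠ ⊤) ∧
      ∃ K : ℝ≥0, LipschitzOnWith K (fun ρ => (densityCost N φ ρ).toReal) S := by
  have hnonconc : UniformlyNonconcentrated (densityMeasure '' S) := by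
    rcases hbound with ⟨p, hp, M, hM⟩ | ⟨M, hM⟩
    · exact uniformlyNonconcentrated_of_eLpNorm_le hd hp hM
    · exact uniformlyNonconcentrated_of_eH1Norm_sqrt_le hd hS hM
  refine hnonconc.exists_lipschitzOnWith_densityCost hS (fun r hr => ?_) N
  exact (hφ r hr).imp fun B hB => forall_mem_image.2 fun t ht => (hB ht).2

theorem mainTheorem8 (N : ℕ) (hN : 1 < N) (φ : ℝ → ℝ)
    (hφ : RepulsiveTransport.IsRepulsivePotential φ) :
    (∀ d : ℕ, 0 < d → ∀ p : ℝ≥0∞, 1 < p →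
      ∀ S : Set (Lp ℝ 1 (volume : Measure (RepulsiveTransport.Space d))),
        S ⊆ RepulsiveTransport.probDensities d →
        (∃ M : ℝ≥0, ∀ ρ ∈ S, eLpNorm ρ p volume ≤ M) →
        (∀ ρ ∈ S, RepulsiveTransport.densityCost N φ ρ ≠ ⊤) ∧
        ∃ K : ℝ≥0,
          LipschitzOnWith K (fun ρ => (RepulsiveTransport.densityCost N φ ρ).toReal) S) ∧
    (∀ S : Set (Lp ℝ 1 (volume : Measure (RepulsiveTransport.Space 3))),
        S ⊆ RepulsiveTransport.dftDensities →
        (∃ M : ℝ≥0, ∀ ρ ∈ S, RepulsiveTransport.eH1Norm (fun x => √(ρ x)) ≤ M) →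
        (∀ ρ ∈ S, RepulsiveTransport.densityCost N φ ρ ≠ ⊤) ∧
        ∃ K : ℝ≥0,
          LipschitzOnWith K (fun ρ => (RepulsiveTransport.densityCost N φ ρ).toReal) S) := by
  exact ⟨fun d hd p hp S hS hM =>
      mainTheorem8_general N (fun _ => hφ.exists_mapsTo_Icc) hd hS (.inl ⟨p, hp, hM⟩),
    fun S hS hM =>
      mainTheorem8_general N (fun _ => hφ.exists_mapsTo_Icc) three_pos
        (fun ρ hρ => ⟨(hS hρ).1, (hS hρ).2.2⟩) (.inr hM)⟩
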